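/- Let $M$ be a closed oriented 3-manifold with an oriented and co-oriented two-dimensional foliation $\mathcal F$ of class $C^2$, i.e. given by an atlas of charts to $\mathbb R^2\times\mathbb R$ whose transition maps are of class $C^{\infty,2}$, preserve the horizontal planes, and preserve the orientations of the planes and of the transverse factor. (A map is of class $C^{\infty,l}$ if all its mixed partial derivatives containing at most $l$ derivatives in the transverse direction exist and are continuous.) Fix a Riemannian metric on the leaves of $\mathcal F$, of class $C^{\infty,1}$ on $M$ (for example the restriction of a smooth Riemannian metric on $M$), and let $\Delta$ be the leafwise Laplacian. Let $\tau$ be a non-vanishing transverse measure of class $C^{\infty,1}$, that is, a $C^{\infty,1}$ 1-form on $M$ with $\ker\tau=T\mathcal F$ that is positive on positively transverse vectors. For a leaf $\lambda$ and a base point $b\in\lambda$, let $f_\tau$ be the function on the universal cover $\widetilde\lambda$ whose value at the class of a leafwise path $\gamma$ starting at $b$ is the factor $|h_\gamma'|_\tau=\tau(h'_\gamma(v))/\tau(v)$ by which the infinitesimal holonomy $h'_\gamma$ along $\gamma$ stretches $\tau$-lengths. It depends on $b$ only up to a positive constant factor, so that $d\log f_\tau$ is a well-defined section of $T^*\mathcal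 F$ over $M$. Orient the leafwise level sets of $f_\tau$ as boundaries of superlevel sets. For $i=1,2$, an $i$-current tangent to $\mathcal F$ is a linear functional on the space of $C^{\infty,1}$ sections of $\Lambda^iT^*\mathcal F$, and $\partial S(\beta)=S(d\beta)$ with $d$ the leafwise exterior derivative. Let $C_2$ be the weak-* closed convex cone of 2-currents generated by the functionals $\omega\mapsto\omega_x(v_1,v_2)$ with $x\in M$ and $(v_1,v_2)$ a positively oriented basis of $T_x\mathcal F$ (the 2-currents contained in and co-oriented with $\mathcal F$). Let $C_1$ be the weak-* closed convex cone of 1-currents generated by the functionals $\beta\mapsto\beta_x(v)$, where $x\in M$ and $v\in T_x\mathcal F$ lies in $\ker (d\log f_\tau)_x$ and is non-negatively oriented, i.e. $(w,v)$ is never a negatively oriented basis of $T_x\mathcal F$ for $w\in T_x\mathcal F$ with $d\log f_\tau(w)<0$; at critical points of $f_\tau$ every $v\in T_x\mathcal F$ is allowed (these are the 1-currents contained in and co-oriented with the level sets of $f_\tau$). An obstruction 2-current for $\tau$ is a non-zero $S\in C_2$ with $-\partial S\in C_1$. Proposition. If $\log f_\tau$ is strictly superharmonic on (the universal cover of) each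 leaf, i.e. $\Delta\log f_\tau<0$ everywhere, then there is no obstruction 2-current for $\tau$. -/

import Mathlib

open Set Filter Topology

noncomputable section

namespace LeafwiseCurrents

/-- The leaf model `ℝ²`. -/
abbrev Plane := EuclideanSpace ℝ (Fin 2)

/-- The local model `ℝ² × ℝ` of a foliated 3-manifold; the leaves of the model are the horizontal
planes `ℝ² × {z}`. -/
abbrev Model := Plane × ℝ

/-- The standard basis vectors of the leaf model. -/
def basisVec (i : Fin 2) : Plane := EuclideanSpace.single i 1

section Regularity

variable {F : Type} [NormedAddCommGroup F] [NormedSpace ℝ F]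
variable {G : Type} [NormedAddCommGroup G] [NormedSpace ℝ G]

/-- The derivative of `f` in the leaf directions. -/
def leafDeriv (f : Model → F) (p : Model) : Plane →L[ℝ] F :=
  fderiv ℝ (fun u : Plane => f (u, p.2)) p.1

/-- The derivative of `f` in the transverse direction. -/
def transDeriv (f : Model → F) (p : Model) : F :=
  deriv (fun s : ℝ => f (p.1, s)) p.2

end Regularity

/-- `IsCkl k l f U`: on the set `U`, all mixed partial derivatives of `f` of total order at most `k`
and of order at most `l` in the transverse direction exist and are continuous. -/
def IsCkl : ℕ → ℕ → ∀ {F : Type} [NormedAddCommGroup F] [NormedSpace ℝ F],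
    (Model → F) → Set Model → Prop
  | 0, _, _, _, _, f, U => ContinuousOn f U
  | k + 1, 0, _, _, _, f, U => ContinuousOn f U ∧
      (∀ p ∈ U, DifferentiableAt ℝ (fun u : Plane => f (u, p.2)) p.1) ∧
      IsCkl k 0 (leafDeriv f) U
  | k + 1, l + 1, _, _, _, f, U => ContinuousOn f U ∧
      (∀ p ∈ U, DifferentiableAt ℝ (fun u : Plane => f (u, p.2)) p.1) ∧
      IsCkl k (l + 1) (leafDeriv f) U ∧
      (∀ p ∈ U, DifferentiableAt ℝ (fun s : ℝ => f (p.1, s)) p.2) ∧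
      IsCkl k l (transDeriv f) U

/-- Regularity class `C^{∞,l}`. -/
def IsCInf (l : ℕ) {F : Type} [NormedAddCommGroup F] [NormedSpace ℝ F]
    (f : Model → F) (U : Set Model) : Prop := ∀ k, IsCkl k l f U

section RegularityLemmas

variable {F : Type} [NormedAddCommGroup F] [NormedSpace ℝ F]
variable {G : Type} [NormedAddCommGroup G] [NormedSpace ℝ G]

theorem slice_leaf_mem {U : Set Model} (hU : IsOpen U) {p : Model} (hp : p ∈ U) :
    ∀ᶠ u in 𝓝 p.1, (u, p.2) ∈ U :=
  (Continuous.prodMk_left p.2).continuousAt.eventually (hU.mem_nhds hp)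

theorem slice_trans_mem {U : Set Model} (hU : IsOpen U) {p : Model} (hp : p ∈ U) :
    ∀ᶠ s in 𝓝 p.2, (p.1, s) ∈ U :=
  (Continuous.prodMk_right p.1).continuousAt.eventually (hU.mem_nhds hp)

theorem IsCkl.continuousOn {k l : ℕ} {f : Model → F} {U : Set Model} (h : IsCkl k l f U) :
    ContinuousOn f U := by
  cases k with
  | zero => exact h
  | succ k => cases l with
    | zero => exact h.1
    | succ l => exact h.1

theorem IsCkl.leaf {k l : ℕ} {f : Model → F} {U : Set Model} (h : IsCkl (k + 1) l f U) :
    (∀ p ∈ U, DifferentiableAt ℝ (fun u : Plane => f (u, p.2)) p.1) ∧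
      IsCkl k l (leafDeriv f) U := by
  cases l with
  | zero => exact h.2
  | succ l => exact ⟨h.2.1, h.2.2.1⟩

theorem IsCkl.congr {U : Set Model} (hU : IsOpen U) {k : ℕ} : ∀ {l : ℕ} {F : Type}
    [NormedAddCommGroup F] [NormedSpace ℝ F] {f g : Model → F}, IsCkl k l f U →
    (∀ p ∈ U, f p = g p) → IsCkl k l g U := by
  induction k with
  | zero =>
    intro l F _ _ f g h hfg
    exact ContinuousOn.congr h fun p hp => (hfg p hp).symm
  | succ k ih =>
    intro l F _ _ f g h hfg
    have e1 : ∀ p ∈ U, (fun u : Plane => f (u, p.2)) =ᶠ[𝓝 p.1] fun u => g (u, p.2) :=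
      fun p hp => (slice_leaf_mem hU hp).mono fun u hu => hfg _ hu
    have e2 : ∀ p ∈ U, (fun s : ℝ => f (p.1, s)) =ᶠ[𝓝 p.2] fun s => g (p.1, s) :=
      fun p hp => (slice_trans_mem hU hp).mono fun u hu => hfg _ hu
    have c : ContinuousOn g U := h.continuousOn.congr fun p hp => (hfg p hp).symm
    have d : ∀ p ∈ U, DifferentiableAt ℝ (fun u : Plane => g (u, p.2)) p.1 :=
      fun p hp => (h.leaf.1 p hp).congr_of_eventuallyEq (e1 p hp).symm
    have i : IsCkl k l (leafDeriv g) U := ih h.leaf.2 fun p hp => (e1 p hp).fderiv_eq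
    cases l with
    | zero => exact ⟨c, d, i⟩
    | succ l =>
      exact ⟨c, d, i, fun p hp => (h.2.2.2.1 p hp).congr_of_eventuallyEq (e2 p hp).symm,
        ih h.2.2.2.2 fun p hp => (e2 p hp).deriv_eq⟩

theorem IsCkl.clm {U : Set Model} (hU : IsOpen U) {k : ℕ} : ∀ {l : ℕ} {F G : Type}
    [NormedAddCommGroup F] [NormedSpace ℝ F] [NormedAddCommGroup G] [NormedSpace ℝ G]
    {f : Model → F} (L : F →L[ℝ] G), IsCkl k l f U → IsCkl k l (fun p => L (f p)) U := by
  induction k with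
  | zero =>
    intro l F G _ _ _ _ f L h
    exact L.continuous.comp_continuousOn h
  | succ k ih =>
    intro l F G _ _ _ _ f L h
    have c : ContinuousOn (fun p => L (f p)) U := L.continuous.comp_continuousOn h.continuousOn
    have d : ∀ p ∈ U, DifferentiableAt ℝ (fun u : Plane => L (f (u, p.2))) p.1 :=
      fun p hp => L.differentiableAt.comp _ (h.leaf.1 p hp)
    have i : IsCkl k l (leafDeriv fun p => L (f p)) U := by
      refine (ih (ContinuousLinearMap.compL ℝ Plane F G L) h.leaf.2).congr hU fun p hp => ?_
      exact (L.hasFDerivAt.comp p.1 (h.leaf.1 p hp).hasFDerivAt).fderiv.symm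
    cases l with
    | zero => exact ⟨c, d, i⟩
    | succ l =>
      refine ⟨c, d, i, fun p hp => L.differentiableAt.comp _ (h.2.2.2.1 p hp),
        (ih L h.2.2.2.2).congr hU fun p hp => ?_⟩
      exact (L.hasFDerivAt.comp_hasDerivAt p.2 (h.2.2.2.1 p hp).hasDerivAt).deriv.symm

theorem IsCkl.add {U : Set Model} (hU : IsOpen U) {k : ℕ} : ∀ {l : ℕ} {F : Type}
    [NormedAddCommGroup F] [NormedSpace ℝ F] {f g : Model → F},
    IsCkl k l f U → IsCkl k l g U → IsCkl k l (fun p => f p + g p) U := by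
  induction k with
  | zero =>
    intro l F _ _ f g hf hg
    exact ContinuousOn.add hf hg
  | succ k ih =>
    intro l F _ _ f g hf hg
    have c : ContinuousOn (fun p => f p + g p) U := hf.continuousOn.add hg.continuousOn
    have d : ∀ p ∈ U, DifferentiableAt ℝ (fun u : Plane => f (u, p.2) + g (u, p.2)) p.1 :=
      fun p hp => (hf.leaf.1 p hp).add (hg.leaf.1 p hp)
    have i : IsCkl k l (leafDeriv fun p => f p + g p) U :=
      (ih hf.leaf.2 hg.leaf.2).congr hU fun p hp =>
        (fderiv_fun_add (hf.leaf.1 p hp) (hg.leaf.1 p hp)).symm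
    cases l with
    | zero => exact ⟨c, d, i⟩
    | succ l =>
      exact ⟨c, d, i, fun p hp => (hf.2.2.2.1 p hp).add (hg.2.2.2.1 p hp),
        (ih hf.2.2.2.2 hg.2.2.2.2).congr hU fun p hp =>
          (deriv_fun_add (hf.2.2.2.1 p hp) (hg.2.2.2.1 p hp)).symm⟩

theorem IsCkl.zero {U : Set Model} {k : ℕ} : ∀ {l : ℕ} {F : Type}
    [NormedAddCommGroup F] [NormedSpace ℝ F], IsCkl k l (fun _ => (0 : F)) U := by
  induction k with
  | zero =>
    intro l F _ _
    exact continuousOn_const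
  | succ k ih =>
    intro l F _ _
    have h1 : leafDeriv (fun _ : Model => (0 : F)) = fun _ => 0 := by
      funext p; simp [leafDeriv]
    have h2 : transDeriv (fun _ : Model => (0 : F)) = fun _ => 0 := by
      funext p; simp [transDeriv]
    cases l with
    | zero =>
      refine ⟨continuousOn_const, fun p _ => differentiableAt_const _, ?_⟩
      rw [h1]; exact ih
    | succ l =>
      refine ⟨continuousOn_const, fun p _ => differentiableAt_const _, ?_,
        fun p _ => differentiableAt_const _, ?_⟩
      · rw [h1]; exact ih
      · rw [h2]; exact ih

theorem IsCkl.contDiffOn_slice {U : Set Model} (hU : IsOpen U) (z : ℝ) {k : ℕ} :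
    ∀ {l : ℕ} {F : Type} [NormedAddCommGroup F] [NormedSpace ℝ F] {f : Model → F},
    IsCkl k l f U → ContDiffOn ℝ k (fun u : Plane => f (u, z)) {u | (u, z) ∈ U} := by
  induction k with
  | zero =>
    intro l F _ _ f h
    refine contDiffOn_zero.2 ?_
    exact ContinuousOn.comp h (Continuous.prodMk_left z).continuousOn fun u hu => hu
  | succ k ih =>
    intro l F _ _ f h
    have ho : IsOpen {u : Plane | (u, z) ∈ U} := hU.preimage (Continuous.prodMk_left z)
    have := (contDiffOn_succ_iff_fderiv_of_isOpen (𝕜 := ℝ) (n := (k : WithTop ℕ∞))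
      (f := fun u : Plane => f (u, z)) ho).2
      ⟨fun u hu => (h.leaf.1 _ hu).differentiableWithinAt,
        fun h => absurd h (WithTop.natCast_ne_top k), ih h.leaf.2⟩
    exact_mod_cast this

end RegularityLemmas

section Manifold

variable (M : Type*) [TopologicalSpace M] [ChartedSpace Model M]

/-- The atlas of the charted space `M` is the atlas of an oriented and co-oriented two-dimensional
foliation of class `C²`, that is `C^{∞,2}`: the transition maps are of class `C^{∞,2}`, they
preserve the decomposition into horizontal planes, the orientation of the horizontal planes and
the orientation of the transverse factor. In particular `M` is oriented. -/
class C2Foliation : Prop where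
  regular : ∀ e ∈ atlas Model M, ∀ e' ∈ atlas Model M,
    IsCInf 2 (fun p => e' (e.symm p)) (e.symm.trans e').source
  horizontal : ∀ e ∈ atlas Model M, ∀ e' ∈ atlas Model M, ∀ p ∈ (e.symm.trans e').source,
    ∀ᶠ q in 𝓝 p, q.2 = p.2 → (e' (e.symm q)).2 = (e' (e.symm p)).2
  leaf_oriented : ∀ e ∈ atlas Model M, ∀ e' ∈ atlas Model M, ∀ p ∈ (e.symm.trans e').source,
    0 < (leafDeriv (fun q => (e' (e.symm q)).1) p).det
  cooriented : ∀ e ∈ atlas Model M, ∀ e' ∈ atlas Model M, ∀ p ∈ (e.symm.trans e').source,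
    0 < transDeriv (fun q => (e' (e.symm q)).2) p

variable {M}

/-- The differential, along the leaf through `x = e.symm p`, of the change of coordinates from the
chart `e` to the preferred chart `chartAt Model x`. As for Mathlib's `TangentSpace`, a vector
tangent to `M` at `x` is given by its coordinates in `Model` with respect to `chartAt Model x`;
the vectors tangent to the leaf through `x` are those with last coordinate zero, so the tangent
plane of the leaf at `x` is identified with `Plane`. -/
def leafChange (e : OpenPartialHomeomorph M Model) (p : Model) : Plane →L[ℝ] Plane :=
  leafDeriv (fun q => (chartAt Model (e.symm p) (e.symm q)).1) p

/-- A leafwise `n`-form `ω` on `M`, given at `x` in the coordinates of `chartAt Model x`, expressed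
in the chart `e`. -/
def formRep {n : ℕ} (ω : M → Plane [⋀^Fin n]→L[ℝ] ℝ) (e : OpenPartialHomeomorph M Model)
    (p : Model) : Plane [⋀^Fin n]→L[ℝ] ℝ :=
  (ω (e.symm p)).compContinuousLinearMap (leafChange e p)

/-- The leafwise `n`-forms (sections of `Λⁿ T*𝓕`) of class `C^{∞,1}`. -/
def LeafForm (M : Type*) [TopologicalSpace M] [ChartedSpace Model M] (n : ℕ) :
    Submodule ℝ (M → Plane [⋀^Fin n]→L[ℝ] ℝ) where
  carrier := {ω | ∀ e ∈ atlas Model M, IsCInf 1 (formRep ω e) e.target}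
  add_mem' := fun {a b} ha hb e he k => by
    have := (ha e he k).add e.open_target (hb e he k)
    exact this.congr e.open_target fun p _ => by ext v; simp [formRep]
  zero_mem' := fun e he k => by
    refine (IsCkl.zero (k := k) (l := 1)).congr e.open_target fun p _ => ?_
    ext v; simp [formRep]
  smul_mem' := fun c a ha e he k => by
    have := (ha e he k).clm e.open_target
      (c • ContinuousLinearMap.id ℝ (Plane [⋀^Fin n]→L[ℝ] ℝ))
    exact this.congr e.open_target fun p _ => by ext v; simp [formRep]

/-- The leafwise exterior derivative, computed at `x` in the chart `chartAt Model x`. -/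
def dFun {n : ℕ} (ω : M → Plane [⋀^Fin n]→L[ℝ] ℝ) (x : M) : Plane [⋀^Fin (n + 1)]→L[ℝ] ℝ :=
  extDeriv (fun u : Plane => formRep ω (chartAt Model x) (u, (chartAt Model x x).2))
    (chartAt Model x x).1

theorem leaf_transition_contDiffAt [C2Foliation M] {e c : OpenPartialHomeomorph M Model}
    (he : e ∈ atlas Model M) (hc : c ∈ atlas Model M) {p : Model}
    (hp : p ∈ (e.symm.trans c).source) :
    ContDiffAt ℝ 2 (fun u : Plane => (c (e.symm (u, p.2))).1) p.1 := by
  have hU : IsOpen (e.symm.trans c).source := (e.symm.trans c).open_source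
  have h := (C2Foliation.regular e he c hc 2).clm hU (ContinuousLinearMap.fst ℝ Plane ℝ)
  have h2 := h.contDiffOn_slice hU p.2
  exact (h2.contDiffAt ((hU.preimage (Continuous.prodMk_left p.2)).mem_nhds hp))

/-- A leafwise form transforms by pullback under changes of charts. -/
theorem formRep_change [C2Foliation M] {n : ℕ} (ω : M → Plane [⋀^Fin n]→L[ℝ] ℝ)
    {e c : OpenPartialHomeomorph M Model} (he : e ∈ atlas Model M) (hc : c ∈ atlas Model M)
    {p : Model} (hp : p ∈ (e.symm.trans c).source) :
    ∀ᶠ u in 𝓝 p.1, formRep ω e (u, p.2) =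
      (formRep ω c ((c (e.symm (u, p.2))).1, (c (e.symm p)).2)).compContinuousLinearMap
        (fderiv ℝ (fun u : Plane => (c (e.symm (u, p.2))).1) u) := by
  have hU : IsOpen (e.symm.trans c).source := (e.symm.trans c).open_source
  have hz : ∀ᶠ u in 𝓝 p.1, (c (e.symm (u, p.2))).2 = (c (e.symm p)).2 := by
    have h := C2Foliation.horizontal e he c hc p hp
    have hc1 : Tendsto (fun u : Plane => ((u, p.2) : Model)) (𝓝 p.1) (𝓝 p) :=
      (Continuous.prodMk_left p.2).tendsto p.1
    exact (hc1.eventually h).mono fun u hu => hu rfl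
  filter_upwards [eventually_eventually_nhds.2 hz, slice_leaf_mem hU hp,
    eventually_eventually_nhds.2 (slice_leaf_mem hU hp)] with u hu hmem hmem'
  have hpair : ((c (e.symm (u, p.2))).1, (c (e.symm p)).2) = c (e.symm (u, p.2)) :=
    Prod.ext rfl hu.self_of_nhds.symm
  have hsrc : e.symm (u, p.2) ∈ c.source := by
    have := hmem
    rw [OpenPartialHomeomorph.trans_source] at this
    exact this.2
  have hq : c.symm ((c (e.symm (u, p.2))).1, (c (e.symm p)).2) = e.symm (u, p.2) := by
    rw [hpair, c.left_inv hsrc]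
  unfold formRep leafChange
  rw [hq]
  set q := e.symm (u, p.2) with hqdef
  set d := chartAt Model q with hd
  have hda : d ∈ atlas Model M := chart_mem_atlas Model q
  have hdq : q ∈ d.source := mem_chart_source Model q
  have hpc : c q ∈ (c.symm.trans d).source := by
    rw [OpenPartialHomeomorph.trans_source]
    refine ⟨c.map_source hsrc, ?_⟩
    simpa [c.left_inv hsrc] using hdq
  have hdiff1 : DifferentiableAt ℝ (fun w : Plane => (d (c.symm (w, (c (e.symm p)).2))).1)
      (c q).1 := by
    have := (leaf_transition_contDiffAt hc hda hpc).differentiableAt (by norm_num)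
    rwa [hu.self_of_nhds] at this
  have hmem2 : (u, p.2) ∈ (e.symm.trans c).source := hmem
  have hdiff2 : DifferentiableAt ℝ (fun u : Plane => (c (e.symm (u, p.2))).1) u :=
    (leaf_transition_contDiffAt he hc hmem2).differentiableAt (by norm_num)
  have key : leafDeriv (fun q' => (d (e.symm q')).1) (u, p.2) =
      (leafDeriv (fun q' => (d (c.symm q')).1) ((c q).1, (c (e.symm p)).2)).comp
        (fderiv ℝ (fun u : Plane => (c (e.symm (u, p.2))).1) u) := by
    unfold leafDeriv
    have hcomp := hdiff1.hasFDerivAt.comp u hdiff2.hasFDerivAt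
    rw [← hcomp.fderiv]
    refine Filter.EventuallyEq.fderiv_eq ?_
    filter_upwards [hu, hmem'] with w hw hwm
    have hpair' : ((c (e.symm (w, p.2))).1, (c (e.symm p)).2) = c (e.symm (w, p.2)) :=
      Prod.ext rfl hw.symm
    have hsrc' : e.symm (w, p.2) ∈ c.source := by
      rw [OpenPartialHomeomorph.trans_source] at hwm
      exact hwm.2
    simp only [Function.comp_apply]
    rw [hpair', c.left_inv hsrc']
  rw [key]
  ext v
  simp [Function.comp_def]

/-- The leafwise exterior derivative may be computed in any chart of the atlas. -/
theorem formRep_dFun [C2Foliation M] {n : ℕ} {ω : M → Plane [⋀^Fin n]→L[ℝ] ℝ}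
    (hω : ω ∈ LeafForm M n) {e : OpenPartialHomeomorph M Model} (he : e ∈ atlas Model M)
    {p : Model} (hp : p ∈ e.target) :
    formRep (dFun ω) e p = extDeriv (fun u : Plane => formRep ω e (u, p.2)) p.1 := by
  have hc : chartAt Model (e.symm p) ∈ atlas Model M := chart_mem_atlas Model _
  have hcs : e.symm p ∈ (chartAt Model (e.symm p)).source := mem_chart_source Model _
  have hps : p ∈ (e.symm.trans (chartAt Model (e.symm p))).source := by
    rw [OpenPartialHomeomorph.trans_source]; exact ⟨hp, hcs⟩
  have h1 := (formRep_change ω he hc hps)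
  rw [Filter.EventuallyEq.extDeriv_eq h1]
  have hd : DifferentiableAt ℝ
      (fun u : Plane => formRep ω (chartAt Model (e.symm p))
        (u, (chartAt Model (e.symm p) (e.symm p)).2))
      (chartAt Model (e.symm p) (e.symm p)).1 :=
    (hω _ hc 1).leaf.1 _ ((chartAt Model (e.symm p)).map_source hcs)
  exact (extDeriv_pullback (r := 2)
    (ω := fun u : Plane => formRep ω (chartAt Model (e.symm p))
        (u, (chartAt Model (e.symm p) (e.symm p)).2))
    (f := fun u : Plane => (chartAt Model (e.symm p) (e.symm (u, p.2))).1) (x := p.1)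
    hd (leaf_transition_contDiffAt he hc hps) (by simp)).symm

/-- The leafwise exterior derivative on leafwise forms of class `C^{∞,1}`. -/
def leafD (M : Type*) [TopologicalSpace M] [ChartedSpace Model M] [C2Foliation M] (n : ℕ) :
    LeafForm M n →ₗ[ℝ] LeafForm M (n + 1) where
  toFun ω := ⟨dFun ω.1, fun e he k => by
    refine ((ω.2 e he (k + 1)).leaf.2.clm e.open_target
      (ContinuousAlternatingMap.alternatizeUncurryFinCLM ℝ Plane ℝ)).congr e.open_target
      fun p hp => ?_
    rw [formRep_dFun ω.2 he hp]
    rfl⟩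
  map_add' a b := by
    refine Subtype.ext (funext fun x => ?_)
    have hx := mem_chart_source Model x
    have ha := (a.2 _ (chart_mem_atlas Model x) 1).leaf.1 _ ((chartAt Model x).map_source hx)
    have hb := (b.2 _ (chart_mem_atlas Model x) 1).leaf.1 _ ((chartAt Model x).map_source hx)
    have := extDeriv_fun_add ha hb
    exact this
  map_smul' c a := by
    refine Subtype.ext (funext fun x => ?_)
    have := extDeriv_fun_smul c
      (fun u : Plane => formRep a.1 (chartAt Model x) (u, (chartAt Model x x).2))
      (x := (chartAt Model x x).1)
    exact this

/-! ### Currents tangent to the foliation -/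

/-- The `n`-currents contained in the foliation: linear functionals on leafwise `n`-forms. -/
abbrev LeafCurrent (M : Type*) [TopologicalSpace M] [ChartedSpace Model M] (n : ℕ) :=
  LeafForm M n →ₗ[ℝ] ℝ

/-- The boundary of a current: `∂S(β) = S(dβ)`. -/
def boundary [C2Foliation M] {n : ℕ} (S : LeafCurrent M (n + 1)) : LeafCurrent M n :=
  S ∘ₗ leafD M n

/-- The functional `ω ↦ ω_x(v₁, …, vₙ)` at a point `x`, for vectors `vᵢ` tangent to the leaf. -/
def pointCurrent {n : ℕ} (x : M) (v : Fin n → Plane) : LeafCurrent M n where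
  toFun ω := ω.1 x v
  map_add' _ _ := rfl
  map_smul' _ _ := rfl

/-- The closed convex cone generated by a set of currents, for the weak-* topology (pointwise
convergence on leafwise forms). -/
def currentCone {n : ℕ} (A : Set (LeafCurrent M n)) : Set (LeafCurrent M n) :=
  {S | (S : LeafForm M n → ℝ) ∈ closure
    ((fun T : LeafCurrent M n => (T : LeafForm M n → ℝ)) '' (PointedCone.hull ℝ A : Set _))}

/-- The cone of 2-currents contained in and co-oriented with the foliation: the closed cone
generated by the positively oriented tangent planes of the leaves. -/
def coorientedCone (M : Type*) [TopologicalSpace M] [ChartedSpace Model M] :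
    Set (LeafCurrent M 2) :=
  currentCone {S | ∃ x : M, S = pointCurrent x ![basisVec 0, basisVec 1]}

/-! ### Transverse measures and holonomy -/

/-- A non-vanishing transverse measure of class `C^{∞,1}`: a 1-form `τ` on `M` with
`ker τ = T𝓕`, positive on positively transverse vectors. As in `leafChange`, `τ x` is expressed in
the coordinates of `chartAt Model x`. -/
structure TransverseMeasure (M : Type*) [TopologicalSpace M] [ChartedSpace Model M] where
  toFun : M → Model →L[ℝ] ℝ
  ker_eq : ∀ x v, toFun x v = 0 ↔ v.2 = 0
  pos : ∀ x, 0 < toFun x (0, 1)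
  regular : ∀ e ∈ atlas Model M, IsCInf 1 (fun p => (toFun (e.symm p)).comp
    (fderiv ℝ (fun q => chartAt Model (e.symm p) (e.symm q)) p)) e.target

/-- The value of `τ` on the transverse coordinate vector `∂/∂z` of the chart `e` at the point with
coordinates `p`. -/
def TransverseMeasure.coeff (τ : TransverseMeasure M) (e : OpenPartialHomeomorph M Model)
    (p : Model) : ℝ :=
  τ.toFun (e.symm p) (fderiv ℝ (fun q => chartAt Model (e.symm p) (e.symm q)) p (0, 1))

/-- Paths tangent to the foliation, from `b` to `x`, as concatenations of subpaths each of which is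
supported in a single chart, where its transverse coordinate is constant. -/
inductive LeafPath (b : M) : M → Type _ where
  | refl : LeafPath b b
  | append {x y : M} (γ : LeafPath b x) (e : OpenPartialHomeomorph M Model)
      (he : e ∈ atlas Model M) (δ : Path x y) (hδ : ∀ t, δ t ∈ e.source)
      (hz : ∀ t, (e (δ t)).2 = (e x).2) : LeafPath b y

/-- The factor `|h'_γ|_τ` by which the infinitesimal holonomy along `γ` stretches `τ`-lengths.
In a chart `e` the holonomy preserves the transverse coordinate, so modulo `T𝓕` its derivative sends
`∂/∂z` at the initial point to `∂/∂z` at the end point. As a function of the (leafwise homotopy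
class of the) path `γ` starting at `b`, this is the Radon-Nikodym derivative `f_τ` on the universal
cover of the leaf through `b`. -/
def holonomyFactor (τ : TransverseMeasure M) {b : M} : ∀ {x : M}, LeafPath b x → ℝ
  | _, .refl => 1
  | _, .append (x := x) (y := y) γ e _ _ _ _ =>
      holonomyFactor τ γ * (τ.coeff e (e y) / τ.coeff e (e x))

/-- The function `log f_τ` near the point of the universal cover of the leaf represented by the path
`γ` from `b` to `x`, in the leaf coordinates `u` of the chart `e` at `x`; see
`logRN_eq_log_holonomyFactor`. -/
def logRN (τ : TransverseMeasure M) {b x : M} (γ : LeafPath b x)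
    (e : OpenPartialHomeomorph M Model) (u : Plane) : ℝ :=
  Real.log (holonomyFactor τ γ * (τ.coeff e (u, (e x).2) / τ.coeff e (e x)))

/-- `logRN τ γ e` gives the values of `log f_τ` at the paths that extend `γ` inside the plaque of
the chart `e` through the end point of `γ`. -/
theorem logRN_eq_log_holonomyFactor (τ : TransverseMeasure M) {b x y : M} (γ : LeafPath b x)
    (e : OpenPartialHomeomorph M Model) (he : e ∈ atlas Model M) (δ : Path x y)
    (hδ : ∀ t, δ t ∈ e.source) (hz : ∀ t, (e (δ t)).2 = (e x).2) :
    Real.log (holonomyFactor τ (γ.append e he δ hδ hz)) = logRN τ γ e (e y).1 := by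
  have h : (e y).2 = (e x).2 := by simpa using hz 1
  simp only [holonomyFactor, logRN]
  rw [← h]

/-- The section `d log f_τ` of `T*𝓕` (it does not depend on the base point of `f_τ`, which is taken
to be `x` at `x`). -/
def dLogRN (τ : TransverseMeasure M) (x : M) : Plane →L[ℝ] ℝ :=
  fderiv ℝ (logRN τ (LeafPath.refl (b := x)) (chartAt Model x)) (chartAt Model x x).1

/-- The oriented area `w ∧ v` in the oriented leaf model. -/
def area (w v : Plane) : ℝ := w 0 * v 1 - w 1 * v 0

/-- The vector `v`, tangent to the leaf at `x`, is tangent to the level set of `f_τ` and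
non-negatively oriented, when level sets are oriented as boundaries of superlevel sets: a vector `w`
pointing out of the superlevel set followed by `v` is never negatively oriented. At critical points
of `f_τ` every vector is allowed. -/
def IsPosLevelVector (τ : TransverseMeasure M) (x : M) (v : Plane) : Prop :=
  dLogRN τ x v = 0 ∧ ∀ w, dLogRN τ x w < 0 → 0 ≤ area w v

/-- The closed cone generated by the 1-currents contained in and co-oriented with the level sets of
`f_τ`. -/
def levelCone (τ : TransverseMeasure M) : Set (LeafCurrent M 1) :=
  currentCone {T | ∃ (x : M) (v : Plane), IsPosLevelVector τ x v ∧ T = pointCurrent x ![v]}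

/-- An obstruction 2-current for `τ`: a non-zero 2-current contained in and co-oriented with the
foliation, whose boundary consists of level sets of `f_τ` with the negative orientation. -/
structure IsObstruction [C2Foliation M] (τ : TransverseMeasure M) (S : LeafCurrent M 2) : Prop where
  ne_zero : S ≠ 0
  cooriented : S ∈ coorientedCone M
  boundary_neg : -boundary S ∈ levelCone τ

/-! ### Leafwise metrics and superharmonicity -/

/-- A leafwise Riemannian metric expressed in the chart `e`. -/
def metricRep (g : M → Plane →L[ℝ] Plane →L[ℝ] ℝ) (e : OpenPartialHomeomorph M Model)
    (p : Model) : Plane →L[ℝ] Plane →L[ℝ] ℝ :=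
  (g (e.symm p)).bilinearComp (leafChange e p) (leafChange e p)

/-- A Riemannian metric on the leaves, of class `C^{∞,1}` on `M`. -/
structure LeafMetric (M : Type*) [TopologicalSpace M] [ChartedSpace Model M] where
  toFun : M → Plane →L[ℝ] Plane →L[ℝ] ℝ
  symm : ∀ x v w, toFun x v w = toFun x w v
  pos : ∀ x v, v ≠ 0 → 0 < toFun x v v
  regular : ∀ e ∈ atlas Model M, IsCInf 1 (metricRep toFun e) e.target

/-- The Gram matrix of the metric on the slice `z = const` of the chart `e`. -/
def LeafMetric.gram (g : LeafMetric M) (e : OpenPartialHomeomorph M Model) (z : ℝ) (u : Plane) :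
    Matrix (Fin 2) (Fin 2) ℝ :=
  fun i j => metricRep g.toFun e (u, z) (basisVec i) (basisVec j)

/-- The Laplace-Beltrami operator `(det G)^{-1/2} ∂ᵢ((det G)^{1/2} G^{ij} ∂ⱼ L)` of a metric with
Gram matrix `G` on an open subset of the plane. -/
def laplaceBeltrami (G : Plane → Matrix (Fin 2) (Fin 2) ℝ) (L : Plane → ℝ) (u : Plane) : ℝ :=
  (√(G u).det)⁻¹ * ∑ i, fderiv ℝ
    (fun y => √(G y).det * ∑ j, (G y)⁻¹ i j * fderiv ℝ L y (basisVec j)) u (basisVec i)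

/-- On the universal cover of each leaf, `log f_τ` is strictly superharmonic: `Δ log f_τ < 0`. -/
def StrictlyLogSuperharmonic (g : LeafMetric M) (τ : TransverseMeasure M) : Prop :=
  ∀ (b x : M) (γ : LeafPath b x), ∀ e ∈ atlas Model M, x ∈ e.source →
    laplaceBeltrami (g.gram e (e x).2) (logRN τ γ e) (e x).1 < 0

end Manifold

end LeafwiseCurrents

end

/-!
Let `β = *d log f_τ` be the leafwise Hodge dual, for the metric `g`, of the closed form
`d log f_τ`. Its leafwise exterior derivative is `Δ log f_τ` times the area form
(`dFun_starDLogRN`), so strict superharmonicity says that `-dβ` is a positive 2-form. On a compact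
manifold any 2-form lies between two multiples of a positive one, and therefore a non-zero current
`S` of the co-oriented cone satisfies `S(-dβ) > 0` (`coorientedCone_apply_pos`). A positively
oriented level vector `v` is a non-negative multiple of minus the gradient of `log f_τ` rotated by
a quarter turn, so `β(v) ≤ 0` (`hodgeStar_nonpos`), and every current of the level cone is
non-positive on `β`. If `-∂S` is such a current, then `S(-dβ) = (-∂S)(β) ≤ 0`, a contradiction.

It has to be checked that `β` is a leafwise form of class `C^{∞,1}` in the sense of `LeafForm`.
In a chart `e`, `d log f_τ` is the leafwise differential of `log τ(∂/∂z)`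
(`dLogRN_comp_leafChange`): a change of charts multiplies `τ(∂/∂z)` by the transverse derivative of
the coordinate change, which is locally constant along the leaves because coordinate changes
preserve the horizontal planes (`eventually_transDeriv_transition_eq`). The Hodge star is natural
under orientation-preserving linear maps (`hodgeStar_comp`), so `β` is given in `e` by the Hodge star of
that differential, and its regularity follows from the closure of `C^{∞,l}` under bilinear maps and
under composition with smooth maps. Only the values of `log f_τ` at paths extending the constant
path inside a plaque are used, since the Laplacian and the differential are local.
-/

noncomputable section

namespace LeafwiseCurrents

/-! ### Closure properties of the class `C^{∞,l}` -/

section Closure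

theorem IsCkl.trans {k l : ℕ} {F : Type} [NormedAddCommGroup F] [NormedSpace ℝ F]
    {f : Model → F} {U : Set Model} (h : IsCkl (k + 1) (l + 1) f U) :
    (∀ p ∈ U, DifferentiableAt ℝ (fun s : ℝ => f (p.1, s)) p.2) ∧ IsCkl k l (transDeriv f) U :=
  h.2.2.2

theorem IsCkl.mono_left {U : Set Model} {k : ℕ} : ∀ {l : ℕ} {F : Type}
    [NormedAddCommGroup F] [NormedSpace ℝ F] {f : Model → F},
    IsCkl (k + 1) l f U → IsCkl k l f U := by
  induction k with
  | zero => exact fun h => h.continuousOn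
  | succ k ih =>
    intro l F _ _ f h
    cases l with
    | zero => exact ⟨h.1, h.2.1, ih h.2.2⟩
    | succ l => exact ⟨h.1, h.2.1, ih h.2.2.1, h.2.2.2.1, ih h.2.2.2.2⟩

theorem IsCkl.mono_right {U : Set Model} {k : ℕ} : ∀ {l : ℕ} {F : Type}
    [NormedAddCommGroup F] [NormedSpace ℝ F] {f : Model → F},
    IsCkl k (l + 1) f U → IsCkl k l f U := by
  induction k with
  | zero => exact fun h => h
  | succ k ih =>
    intro l F _ _ f h
    cases l with
    | zero => exact ⟨h.1, h.2.1, ih h.2.2.1⟩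
    | succ l => exact ⟨h.1, h.2.1, ih h.2.2.1, h.2.2.2.1, ih h.2.2.2.2⟩

/-- The class `C^{k,l}` is closed under bilinear products. The induction on `k` needs all bilinear
maps at once, since the Leibniz rule replaces `B` by its pre-compositions. -/
theorem IsCkl.bilinear {U : Set Model} (hU : IsOpen U) {k : ℕ} : ∀ {l : ℕ} {F G H : Type}
    [NormedAddCommGroup F] [NormedSpace ℝ F] [NormedAddCommGroup G] [NormedSpace ℝ G]
    [NormedAddCommGroup H] [NormedSpace ℝ H] {f : Model → F} {g : Model → G}
    (B : F →L[ℝ] G →L[ℝ] H), IsCkl k l f U → IsCkl k l g U →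
    IsCkl k l (fun p => B (f p) (g p)) U := by
  induction k with
  | zero =>
    intro l F G H _ _ _ _ _ _ f g B hf hg
    exact ContinuousOn.clm_apply (B.continuous.comp_continuousOn hf) hg
  | succ k ih =>
    intro l F G H _ _ _ _ _ _ f g B hf hg
    have c : ContinuousOn (fun p => B (f p) (g p)) U :=
      ContinuousOn.clm_apply (B.continuous.comp_continuousOn hf.continuousOn) hg.continuousOn
    have d : ∀ p ∈ U, HasFDerivAt (fun u : Plane => B (f (u, p.2)) (g (u, p.2)))
        (B.precompR Plane (f p) (leafDeriv g p) + B.precompL Plane (leafDeriv f p) (g p)) p.1 :=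
      fun p hp => B.hasFDerivAt_of_bilinear (hf.leaf.1 p hp).hasFDerivAt
        (hg.leaf.1 p hp).hasFDerivAt
    have i : IsCkl k l (leafDeriv fun p => B (f p) (g p)) U :=
      ((ih (B.precompR Plane) hf.mono_left hg.leaf.2).add hU
        (ih (B.precompL Plane) hf.leaf.2 hg.mono_left)).congr hU
        fun p hp => (d p hp).fderiv.symm
    cases l with
    | zero => exact ⟨c, fun p hp => (d p hp).differentiableAt, i⟩
    | succ l =>
      have t : ∀ p ∈ U, HasDerivAt (fun s : ℝ => B (f (p.1, s)) (g (p.1, s)))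
          (B (f p) (transDeriv g p) + B (transDeriv f p) (g p)) p.2 := fun p hp =>
        B.hasDerivAt_of_bilinear (fun _ => (hf.trans.1 p hp).hasDerivAt)
          fun _ => (hg.trans.1 p hp).hasDerivAt
      exact ⟨c, fun p hp => (d p hp).differentiableAt, i,
        fun p hp => (t p hp).differentiableAt,
        ((ih B hf.mono_left.mono_right hg.trans.2).add hU
          (ih B hf.trans.2 hg.mono_left.mono_right)).congr hU
          fun p hp => (t p hp).deriv.symm⟩

/-- The class `C^{k,l}` is closed under post-composition with smooth maps. Smoothness of `φ` is
needed only on an open set containing the values of `f`, as for `log` and `x ↦ (√x)⁻¹`. -/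
theorem IsCkl.contDiffOn_comp {U : Set Model} (hU : IsOpen U) {k : ℕ} : ∀ {l : ℕ} {F G : Type}
    [NormedAddCommGroup F] [NormedSpace ℝ F] [NormedAddCommGroup G] [NormedSpace ℝ G]
    {f : Model → F} {φ : F → G} {s : Set F}, IsOpen s → ContDiffOn ℝ k φ s →
    (∀ p ∈ U, f p ∈ s) → IsCkl k l f U → IsCkl k l (fun p => φ (f p)) U := by
  induction k with
  | zero =>
    intro l F G _ _ _ _ f φ s _ hφ hs hf
    exact hφ.continuousOn.comp hf hs
  | succ k ih =>
    intro l F G _ _ _ _ f φ s ho hφ hs hf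
    have hφd : ∀ y ∈ s, HasFDerivAt φ (fderiv ℝ φ y) y := fun y hy =>
      ((hφ.contDiffAt (ho.mem_nhds hy)).differentiableAt (by norm_cast)).hasFDerivAt
    have hφ' : ContDiffOn ℝ k (fderiv ℝ φ) s := hφ.fderiv_of_isOpen ho (by norm_cast)
    have c : ContinuousOn (fun p => φ (f p)) U := hφ.continuousOn.comp hf.continuousOn hs
    have d : ∀ p ∈ U, HasFDerivAt (fun u : Plane => φ (f (u, p.2)))
        ((fderiv ℝ φ (f p)).comp (leafDeriv f p)) p.1 := fun p hp =>
      (hφd _ (hs p hp)).comp p.1 (hf.leaf.1 p hp).hasFDerivAt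
    have h' : ∀ {l : ℕ}, IsCkl k l f U → IsCkl k l (fun p => fderiv ℝ φ (f p)) U :=
      fun h => ih ho hφ' hs h
    have i : IsCkl k l (leafDeriv fun p => φ (f p)) U :=
      (IsCkl.bilinear hU (ContinuousLinearMap.compL ℝ Plane F G) (h' hf.mono_left)
        hf.leaf.2).congr hU fun p hp => (d p hp).fderiv.symm
    cases l with
    | zero => exact ⟨c, fun p hp => (d p hp).differentiableAt, i⟩
    | succ l =>
      have t : ∀ p ∈ U, HasDerivAt (fun r : ℝ => φ (f (p.1, r)))
          (fderiv ℝ φ (f p) (transDeriv f p)) p.2 := fun p hp =>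
        (hφd _ (hs p hp)).comp_hasDerivAt p.2 (hf.trans.1 p hp).hasDerivAt
      exact ⟨c, fun p hp => (d p hp).differentiableAt, i,
        fun p hp => (t p hp).differentiableAt,
        (IsCkl.bilinear hU (ContinuousLinearMap.id ℝ (F →L[ℝ] G))
          (h' hf.mono_left.mono_right) hf.trans.2).congr hU fun p hp => (t p hp).deriv.symm⟩

end Closure

/-! ### Coordinate changes and the derivative of `log f_τ` -/

section Coordinates

/-- Continuity of the leafwise and transverse partial derivatives gives Fréchet differentiability,
so that the `fderiv` in the definition of `TransverseMeasure.coeff` is not a junk value. -/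
theorem IsCkl.hasFDerivAt {F : Type} [NormedAddCommGroup F] [NormedSpace ℝ F] {f : Model → F}
    {U : Set Model} (hU : IsOpen U) {k l : ℕ} (h : IsCkl (k + 1) (l + 1) f U) {p : Model}
    (hp : p ∈ U) : HasFDerivAt f
      ((leafDeriv f p).coprod (ContinuousLinearMap.toSpanSingleton ℝ (transDeriv f p))) p := by
  have hn : ∀ᶠ q in 𝓝 p, q ∈ U := hU.mem_nhds hp
  exact (hasStrictFDerivAt_uncurry_coprod (f := fun a b => f (a, b))
    (f₁ := fun a b => leafDeriv f (a, b))
    (f₂ := fun a b => ContinuousLinearMap.toSpanSingleton ℝ (transDeriv f (a, b)))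
    (hn.mono fun q hq => (h.leaf.1 q hq).hasFDerivAt)
    (hn.mono fun q hq => (h.trans.1 q hq).hasDerivAt.hasFDerivAt)
    (h.leaf.2.continuousOn.continuousAt hn)
    ((ContinuousLinearMap.toSpanSingletonCLE (𝕜 := ℝ)
      (E := F)).continuous.continuousAt.comp
        (h.trans.2.continuousOn.continuousAt hn))).hasFDerivAt

theorem mem_transition_source {M : Type*} [TopologicalSpace M]
    {e c : OpenPartialHomeomorph M Model} {p : Model} (hp : p ∈ e.target)
    (hc : e.symm p ∈ c.source) :
    p ∈ (e.symm.trans c).source := by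
  rw [OpenPartialHomeomorph.trans_source]
  exact ⟨hp, hc⟩

theorem TransverseMeasure.apply_eq {M : Type*} [TopologicalSpace M] [ChartedSpace Model M]
    (τ : TransverseMeasure M) (x : M) (v : Model) :
    τ.toFun x v = τ.toFun x (0, 1) * v.2 := by
  have h : v = (v.1, 0) + v.2 • ((0, 1) : Model) := by ext <;> simp
  have h0 : τ.toFun x (v.1, 0) = 0 := (τ.ker_eq x _).2 rfl
  conv_lhs => rw [h]
  rw [map_add, map_smul, h0, zero_add, smul_eq_mul, mul_comm]

variable {M : Type*} [TopologicalSpace M] [ChartedSpace Model M] [C2Foliation M]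
variable {e c d : OpenPartialHomeomorph M Model} {p : Model}

theorem transition_isCkl (he : e ∈ atlas Model M) (hc : c ∈ atlas Model M) :
    IsCkl 2 2 (fun q => c (e.symm q)) (e.symm.trans c).source :=
  C2Foliation.regular e he c hc 2

theorem transition_snd_isCkl (he : e ∈ atlas Model M) (hc : c ∈ atlas Model M) :
    IsCkl 2 2 (fun q => (c (e.symm q)).2) (e.symm.trans c).source :=
  (transition_isCkl he hc).clm (e.symm.trans c).open_source (ContinuousLinearMap.snd ℝ Plane ℝ)

/-- The transverse component of a coordinate change is, locally, a function of the transverse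
coordinate alone: its leafwise derivative vanishes near `p`. -/
theorem eventually_transition_snd_eq (he : e ∈ atlas Model M) (hc : c ∈ atlas Model M)
    (hp : p ∈ (e.symm.trans c).source) :
    ∀ᶠ q in 𝓝 p, (c (e.symm q)).2 = (c (e.symm (p.1, q.2))).2 := by
  have hU := (e.symm.trans c).open_source
  obtain ⟨r, hr, hball⟩ := Metric.isOpen_iff.1 hU p hp
  have hzero : ∀ q ∈ (e.symm.trans c).source,
      HasFDerivAt (fun u : Plane => (c (e.symm (u, q.2))).2) (0 : Plane →L[ℝ] ℝ) q.1 := by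
    intro q hq
    have h := C2Foliation.horizontal e he c hc q hq
    have ht : Tendsto (fun u : Plane => ((u, q.2) : Model)) (𝓝 q.1) (𝓝 q) :=
      (Continuous.prodMk_left q.2).tendsto q.1
    exact (hasFDerivAt_const ((c (e.symm q)).2) q.1).congr_of_eventuallyEq
      ((ht.eventually h).mono fun u hu => hu rfl)
  filter_upwards [Metric.ball_mem_nhds p hr] with q hq
  rw [← ball_prod_same] at hq hball
  have hd : ∀ u ∈ Metric.ball p.1 r, HasFDerivWithinAt (fun u : Plane => (c (e.symm (u, q.2))).2)
      (0 : Plane →L[ℝ] ℝ) (Metric.ball p.1 r) u := fun u hu =>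
    (hzero (u, q.2) (hball ⟨hu, hq.2⟩)).hasFDerivWithinAt
  exact (convex_ball p.1 r).is_const_of_fderivWithin_eq_zero (𝕜 := ℝ)
    (f := fun u : Plane => (c (e.symm (u, q.2))).2)
    (fun u hu => (hd u hu).differentiableWithinAt)
    (fun u hu => (hd u hu).fderivWithin (Metric.isOpen_ball.uniqueDiffWithinAt hu))
    hq.1 (Metric.mem_ball_self hr)

/-- Along the leaves the transverse derivative of a coordinate change is locally constant. -/
theorem eventually_transDeriv_transition_eq (he : e ∈ atlas Model M) (hc : c ∈ atlas Model M)
    (hp : p ∈ (e.symm.trans c).source) :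
    ∀ᶠ u in 𝓝 p.1, transDeriv (fun q => (c (e.symm q)).2) (u, p.2) =
      transDeriv (fun q => (c (e.symm q)).2) p := by
  have ht : Tendsto (fun u : Plane => ((u, p.2) : Model)) (𝓝 p.1) (𝓝 p) :=
    (Continuous.prodMk_left p.2).tendsto p.1
  filter_upwards [ht.eventually (eventually_transition_snd_eq he hc hp).eventually_nhds]
    with u hu
  have hs : Tendsto (fun s : ℝ => ((u, s) : Model)) (𝓝 p.2) (𝓝 (u, p.2)) :=
    (Continuous.prodMk_right u).tendsto p.2
  exact Filter.EventuallyEq.deriv_eq (hs.eventually hu)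

/-- The chain rule for the transverse derivatives of coordinate changes; leafwise derivatives do not
enter because the transverse component depends on the transverse coordinate alone. -/
theorem transDeriv_transition_comp (he : e ∈ atlas Model M) (hc : c ∈ atlas Model M)
    (hd : d ∈ atlas Model M) (hp : p ∈ e.target) (hpc : e.symm p ∈ c.source)
    (hpd : e.symm p ∈ d.source) :
    transDeriv (fun q => (d (e.symm q)).2) p =
      transDeriv (fun q => (d (c.symm q)).2) (c (e.symm p)) *
        transDeriv (fun q => (c (e.symm q)).2) p := by
  have hpU := mem_transition_source hp hpc
  have hqU : c (e.symm p) ∈ (c.symm.trans d).source :=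
    mem_transition_source (c.map_source hpc) (by rwa [c.left_inv hpc])
  have h1 := ((transition_snd_isCkl he hc).trans.1 p hpU).hasDerivAt
  have h2 := ((transition_snd_isCkl hc hd).trans.1 _ hqU).hasDerivAt
  refine (HasDerivAt.comp p.2 h2 h1).congr_of_eventuallyEq ?_ |>.deriv
  have hs : Tendsto (fun s : ℝ => ((p.1, s) : Model)) (𝓝 p.2) (𝓝 p) :=
    (Continuous.prodMk_right p.1).tendsto p.2
  have hct : ContinuousAt (fun q => c (e.symm q)) p :=
    (transition_isCkl he hc).continuousOn.continuousAt
      ((e.symm.trans c).open_source.mem_nhds hpU)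
  filter_upwards [(hct.tendsto.comp hs).eventually (eventually_transition_snd_eq hc hd hqU),
    slice_trans_mem (e.symm.trans c).open_source hpU] with s hs hmem
  rw [OpenPartialHomeomorph.trans_source] at hmem
  have := c.left_inv hmem.2
  simp only [Function.comp_apply] at hs ⊢
  rw [← hs, this]

theorem fderiv_transition_transverse (he : e ∈ atlas Model M) (hc : c ∈ atlas Model M)
    (hp : p ∈ (e.symm.trans c).source) :
    (fderiv ℝ (fun q => c (e.symm q)) p (0, 1)).2 =
      transDeriv (fun q => (c (e.symm q)).2) p := by
  have h := (transition_isCkl he hc).hasFDerivAt (e.symm.trans c).open_source hp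
  have h2 := (transition_isCkl he hc).trans.1 p hp
  rw [h.fderiv]
  have h3 : HasDerivAt (fun s => (c (e.symm (p.1, s))).2)
      (transDeriv (fun q => c (e.symm q)) p).2 p.2 :=
    (ContinuousLinearMap.snd ℝ Plane ℝ).hasFDerivAt.comp_hasDerivAt p.2 h2.hasDerivAt
  exact (by simp : _ = (transDeriv (fun q => c (e.symm q)) p).2).trans h3.deriv.symm

/-- Since `τ` vanishes on the leaf directions, `τ(∂/∂z)` only sees the transverse component of
`∂/∂z` in the preferred chart. -/
theorem TransverseMeasure.coeff_eq (τ : TransverseMeasure M) (he : e ∈ atlas Model M)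
    (hp : p ∈ e.target) : τ.coeff e p = τ.toFun (e.symm p) (0, 1) *
      transDeriv (fun q => (chartAt Model (e.symm p) (e.symm q)).2) p := by
  rw [coeff, τ.apply_eq, fderiv_transition_transverse he (chart_mem_atlas _ _)
    (mem_transition_source hp (mem_chart_source _ _))]

theorem TransverseMeasure.coeff_pos (τ : TransverseMeasure M) (he : e ∈ atlas Model M)
    (hp : p ∈ e.target) : 0 < τ.coeff e p := by
  rw [τ.coeff_eq he hp]
  exact mul_pos (τ.pos _) (C2Foliation.cooriented e he _ (chart_mem_atlas _ _) p
    (mem_transition_source hp (mem_chart_source _ _)))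

theorem TransverseMeasure.coeff_change (τ : TransverseMeasure M) (he : e ∈ atlas Model M)
    (hc : c ∈ atlas Model M) (hp : p ∈ e.target) (hpc : e.symm p ∈ c.source) :
    τ.coeff e p = τ.coeff c (c (e.symm p)) * transDeriv (fun q => (c (e.symm q)).2) p := by
  rw [τ.coeff_eq he hp, τ.coeff_eq hc (c.map_source hpc), c.left_inv hpc, mul_assoc,
    transDeriv_transition_comp he hc (chart_mem_atlas _ _) hp hpc (mem_chart_source _ _)]

theorem TransverseMeasure.isCInf_log_coeff (τ : TransverseMeasure M) (he : e ∈ atlas Model M) :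
    IsCInf 1 (fun p => Real.log (τ.coeff e p)) e.target := fun k =>
  IsCkl.contDiffOn_comp e.open_target isOpen_compl_singleton
    (Real.contDiffOn_log.of_le le_top)
    (fun _ hp => (τ.coeff_pos he hp).ne')
    ((τ.regular e he k).clm e.open_target (ContinuousLinearMap.apply ℝ ℝ ((0, 1) : Model)))

theorem logRN_refl_eventuallyEq (τ : TransverseMeasure M) (he : e ∈ atlas Model M)
    {x : M} (hx : x ∈ e.source) {u : Plane} (hu : (u, (e x).2) ∈ e.target) :
    logRN τ (LeafPath.refl (b := x)) e =ᶠ[𝓝 u] fun w =>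
      Real.log (τ.coeff e (w, (e x).2)) - Real.log (τ.coeff e (e x)) := by
  filter_upwards [slice_leaf_mem e.open_target hu] with w hw
  rw [logRN, holonomyFactor, one_mul, Real.log_div (τ.coeff_pos he hw).ne'
    (τ.coeff_pos he (e.map_source hx)).ne']

theorem fderiv_logRN_refl (τ : TransverseMeasure M) (he : e ∈ atlas Model M)
    {x : M} (hx : x ∈ e.source) {u : Plane} (hu : (u, (e x).2) ∈ e.target) :
    fderiv ℝ (logRN τ (LeafPath.refl (b := x)) e) u =
      leafDeriv (fun q => Real.log (τ.coeff e q)) (u, (e x).2) := by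
  rw [(logRN_refl_eventuallyEq τ he hx hu).fderiv_eq, fderiv_sub_const]
  rfl

theorem dLogRN_eq (τ : TransverseMeasure M) (x : M) :
    dLogRN τ x = leafDeriv (fun q => Real.log (τ.coeff (chartAt Model x) q))
      (chartAt Model x x) :=
  fderiv_logRN_refl τ (chart_mem_atlas _ _) (mem_chart_source _ _)
    ((chartAt Model x).map_source (mem_chart_source _ _))

/-- In the chart `e` the form `d log f_τ` is the leafwise differential of `log τ(∂/∂z)`. Under a
change of charts `τ(∂/∂z)` is multiplied by a factor that is constant along the leaves. -/
theorem dLogRN_comp_leafChange (τ : TransverseMeasure M) (he : e ∈ atlas Model M)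
    (hp : p ∈ e.target) :
    (dLogRN τ (e.symm p)).comp (leafChange e p) =
      leafDeriv (fun q => Real.log (τ.coeff e q)) p := by
  rw [dLogRN_eq, leafChange]
  have hc := chart_mem_atlas Model (e.symm p)
  have hpc := mem_chart_source Model (e.symm p)
  set c := chartAt Model (e.symm p)
  have hpU := mem_transition_source hp hpc
  have h1 := ((τ.isCInf_log_coeff hc 1).leaf.1 _ (c.map_source hpc)).hasFDerivAt
  have h2 := ((leaf_transition_contDiffAt he hc hpU).differentiableAt (by norm_num)).hasFDerivAt
  have h3 := (HasFDerivAt.comp p.1 h1 h2).add_const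
    (Real.log (transDeriv (fun q => (c (e.symm q)).2) p))
  refine (h3.congr_of_eventuallyEq ?_).fderiv.symm
  have ht : Tendsto (fun u : Plane => ((u, p.2) : Model)) (𝓝 p.1) (𝓝 p) :=
    (Continuous.prodMk_left p.2).tendsto p.1
  filter_upwards [slice_leaf_mem (e.symm.trans c).open_source hpU,
    eventually_transDeriv_transition_eq he hc hpU,
    ht.eventually (C2Foliation.horizontal e he c hc p hpU)] with u hu hu2 hu3
  have hu' := hu
  rw [OpenPartialHomeomorph.trans_source] at hu'
  rw [τ.coeff_change he hc hu'.1 hu'.2, hu2, Real.log_mul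
    (τ.coeff_pos hc (c.map_source hu'.2)).ne' (C2Foliation.cooriented e he c hc p hpU).ne']
  simp only [Function.comp_apply]
  rw [← hu3 rfl]

end Coordinates

/-! ### The Hodge star of the plane -/

section HodgeStar

/-- The determinant of the Gram matrix of the bilinear form `h` in the standard basis. -/
def gramDet (h : Plane →L[ℝ] Plane →L[ℝ] ℝ) : ℝ :=
  h (basisVec 0) (basisVec 0) * h (basisVec 1) (basisVec 1) -
    h (basisVec 0) (basisVec 1) * h (basisVec 1) (basisVec 0)

/-- The Hodge star of the covector `α` for the metric `h` and the standard orientation of the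
plane. In the metric duality `α₀ h(e₁, ·) - α₁ h(e₀, ·)` is the vector `α₀ e₁ - α₁ e₀`, which spans
`ker α`. -/
def hodgeStar (h : Plane →L[ℝ] Plane →L[ℝ] ℝ) (α : Plane →L[ℝ] ℝ) : Plane →L[ℝ] ℝ :=
  (√(gramDet h))⁻¹ • (α (basisVec 0) • h (basisVec 1) - α (basisVec 1) • h (basisVec 0))

theorem hodgeStar_apply (h : Plane →L[ℝ] Plane →L[ℝ] ℝ) (α : Plane →L[ℝ] ℝ) (v : Plane) :
    hodgeStar h α v = (√(gramDet h))⁻¹ *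
      (α (basisVec 0) * h (basisVec 1) v - α (basisVec 1) * h (basisVec 0) v) := by
  simp [hodgeStar]

theorem plane_eq (v : Plane) : v = v 0 • basisVec 0 + v 1 • basisVec 1 := by
  ext i; fin_cases i <;> simp [basisVec]

theorem basisFun_eq :
    ⇑(EuclideanSpace.basisFun (Fin 2) ℝ).toBasis = ![basisVec 0, basisVec 1] := by
  funext i; fin_cases i <;> simp [basisVec]

/-- A linear map multiplies the value of a top-degree form on the standard basis by its
determinant. -/
theorem alternating_map_basis (f : Plane [⋀^Fin 2]→L[ℝ] ℝ) (A : Plane →L[ℝ] Plane) :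
    f ![A (basisVec 0), A (basisVec 1)] = A.det * f ![basisVec 0, basisVec 1] := by
  have h := congrArg (fun F : Plane [⋀^Fin 2]→ₗ[ℝ] ℝ => F (A ∘ ![basisVec 0, basisVec 1]))
    (f.toAlternatingMap.eq_smul_basis_det (EuclideanSpace.basisFun (Fin 2) ℝ).toBasis)
  have h2 := Module.Basis.det_comp (EuclideanSpace.basisFun (Fin 2) ℝ).toBasis
    (A : Plane →ₗ[ℝ] Plane) ![basisVec 0, basisVec 1]
  rw [← basisFun_eq, Module.Basis.det_self, basisFun_eq, mul_one] at h2
  rw [AlternatingMap.smul_apply, smul_eq_mul] at h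
  have h3 : A ∘ ![basisVec 0, basisVec 1] = ![A (basisVec 0), A (basisVec 1)] := by
    funext i; fin_cases i <;> rfl
  have h4 : (A : Plane →ₗ[ℝ] Plane) ∘ ![basisVec 0, basisVec 1] =
      ![A (basisVec 0), A (basisVec 1)] := h3
  rw [h4] at h2
  rw [h3, h2, basisFun_eq, mul_comm] at h
  exact h

theorem det_eq (A : Plane →L[ℝ] Plane) :
    A.det = A (basisVec 0) 0 * A (basisVec 1) 1 - A (basisVec 0) 1 * A (basisVec 1) 0 := by
  rw [ContinuousLinearMap.det, ← LinearMap.det_toMatrix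
    (EuclideanSpace.basisFun (Fin 2) ℝ).toBasis, Matrix.det_fin_two]
  simp [LinearMap.toMatrix_apply, basisVec]
  ring

theorem gramDet_comp (h : Plane →L[ℝ] Plane →L[ℝ] ℝ) (A : Plane →L[ℝ] Plane) :
    gramDet (h.bilinearComp A A) = A.det ^ 2 * gramDet h := by
  rw [det_eq]
  simp only [gramDet, ContinuousLinearMap.bilinearComp_apply]
  rw [plane_eq (A (basisVec 0)), plane_eq (A (basisVec 1))]
  simp [basisVec]
  ring

/-- The Hodge star commutes with pullback by orientation-preserving linear maps. -/
theorem hodgeStar_comp (h : Plane →L[ℝ] Plane →L[ℝ] ℝ) (α : Plane →L[ℝ] ℝ)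
    (A : Plane →L[ℝ] Plane) (hA : 0 < A.det) :
    (hodgeStar h α).comp A = hodgeStar (h.bilinearComp A A) (α.comp A) := by
  ext v
  rw [ContinuousLinearMap.comp_apply, hodgeStar_apply, hodgeStar_apply, gramDet_comp,
    Real.sqrt_mul (sq_nonneg _), Real.sqrt_sq hA.le]
  simp only [ContinuousLinearMap.bilinearComp_apply, ContinuousLinearMap.comp_apply]
  have key : α (A (basisVec 0)) * h (A (basisVec 1)) (A v) -
      α (A (basisVec 1)) * h (A (basisVec 0)) (A v) = A.det *
      (α (basisVec 0) * h (basisVec 1) (A v) - α (basisVec 1) * h (basisVec 0) (A v)) := by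
    rw [det_eq]
    generalize A v = w
    rw [plane_eq (A (basisVec 0)), plane_eq (A (basisVec 1))]
    simp [basisVec]
    ring
  rw [key, mul_inv]
  field_simp

theorem gramDet_pos {h : Plane →L[ℝ] Plane →L[ℝ] ℝ} (hs : ∀ v w, h v w = h w v)
    (hp : ∀ v, v ≠ 0 → 0 < h v v) : 0 < gramDet h := by
  have h0 : 0 < h (basisVec 0) (basisVec 0) := hp _ fun h0 => by
    have := congrArg (fun v : Plane => v 0) h0
    simp [basisVec] at this
  -- `h₀₀ e₁ - h₀₁ e₀` spans the `h`-orthogonal complement of `e₀`; its square length is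
  -- `h₀₀ det h`.
  have h1 : 0 < h (h (basisVec 0) (basisVec 0) • basisVec 1 -
      h (basisVec 0) (basisVec 1) • basisVec 0) (h (basisVec 0) (basisVec 0) • basisVec 1 -
      h (basisVec 0) (basisVec 1) • basisVec 0) := hp _ fun h1 => by
    have := congrArg (fun v : Plane => v 1) h1
    simp [basisVec] at this
    exact h0.ne' this
  simp only [map_sub, map_smul, sub_apply, smul_apply, smul_eq_mul] at h1
  refine pos_of_mul_pos_right (a := h (basisVec 0) (basisVec 0)) (h1.trans_eq ?_) h0.le
  rw [gramDet, hs (basisVec 1) (basisVec 0)]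
  ring

/-- The Hodge star of `α` is non-positive on the vectors of `ker α` that are oriented as the
boundary of the half-plane `α > 0`. -/
theorem hodgeStar_nonpos {h : Plane →L[ℝ] Plane →L[ℝ] ℝ} (hp : ∀ v, v ≠ 0 → 0 < h v v)
    {α : Plane →L[ℝ] ℝ} {v : Plane} (hv : α v = 0) (hw : ∀ w, α w < 0 → 0 ≤ area w v) :
    hodgeStar h α v ≤ 0 := by
  rw [hodgeStar_apply]
  refine mul_nonpos_of_nonneg_of_nonpos (inv_nonneg.2 (Real.sqrt_nonneg _)) ?_
  set a := α (basisVec 0) with ha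
  set b := α (basisVec 1) with hb
  by_cases hab : a ^ 2 + b ^ 2 = 0
  · have ha0 : a = 0 := by nlinarith [sq_nonneg a, sq_nonneg b]
    have hb0 : b = 0 := by nlinarith [sq_nonneg a, sq_nonneg b]
    simp [ha0, hb0]
  have hpos : 0 < a ^ 2 + b ^ 2 := lt_of_le_of_ne (by positivity) (Ne.symm hab)
  have hα : ∀ w : Plane, α w = w 0 * a + w 1 * b := fun w => by
    conv_lhs => rw [plane_eq w]
    simp [ha, hb]
  -- `-(a, b)` is minus the Euclidean gradient of `α`, so it points out of `α > 0`.
  have h1 := hw (-(a • basisVec 0 + b • basisVec 1)) (by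
    rw [hα]; simp [basisVec]; nlinarith)
  have h2 : 0 ≤ -(a * v 1 - b * v 0) := by
    refine h1.trans_eq ?_
    simp [area, basisVec]; ring
  rw [hα] at hv
  -- `v` is a multiple of the vector `a e₁ - b e₀`, which spans the kernel of `α` when `α ≠ 0`.
  have h3 : (a ^ 2 + b ^ 2) • v =
      (a * v 1 - b * v 0) • (a • basisVec 1 - b • basisVec 0 : Plane) := by
    ext i; fin_cases i
    · simp [basisVec]; linear_combination a * hv
    · simp [basisVec]; linear_combination b * hv
  have h4 : a * h (basisVec 1) v - b * h (basisVec 0) v =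
      h (a • basisVec 1 - b • basisVec 0) v := by simp
  rw [h4]
  have h5 : (a ^ 2 + b ^ 2) * h (a • basisVec 1 - b • basisVec 0) v = (a * v 1 - b * v 0) *
      h (a • basisVec 1 - b • basisVec 0) (a • basisVec 1 - b • basisVec 0) := by
    rw [← smul_eq_mul, ← map_smul, h3, map_smul, smul_eq_mul]
  have h6 : 0 ≤ h (a • basisVec 1 - b • basisVec 0) (a • basisVec 1 - b • basisVec 0) := by
    rcases eq_or_ne (a • basisVec 1 - b • basisVec 0 : Plane) 0 with h0 | h0
    · simp [h0]
    · exact (hp _ h0).le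
  by_contra hcon
  push Not at hcon
  nlinarith [mul_pos hpos hcon, mul_nonneg h2 h6]

end HodgeStar

/-! ### The form `*d log f_τ` and its exterior derivative -/

section StarForm

theorem IsCkl.sub {U : Set Model} (hU : IsOpen U) {k l : ℕ} {F : Type} [NormedAddCommGroup F]
    [NormedSpace ℝ F] {f g : Model → F} (hf : IsCkl k l f U) (hg : IsCkl k l g U) :
    IsCkl k l (fun p => f p - g p) U :=
  (hf.add hU (hg.clm hU (-ContinuousLinearMap.id ℝ F))).congr hU fun p _ => by
    simp [sub_eq_add_neg]

theorem IsCkl.hodgeStar {U : Set Model} (hU : IsOpen U) {k l : ℕ}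
    {h : Model → Plane →L[ℝ] Plane →L[ℝ] ℝ} {α : Model → Plane →L[ℝ] ℝ}
    (hh : IsCkl k l h U) (hα : IsCkl k l α U) (hpos : ∀ p ∈ U, 0 < gramDet (h p)) :
    IsCkl k l (fun p => hodgeStar (h p) (α p)) U := by
  have h1 : ∀ i, IsCkl k l (fun p => h p (basisVec i)) U := fun i =>
    hh.clm hU (ContinuousLinearMap.apply ℝ (Plane →L[ℝ] ℝ) (basisVec i))
  have h2 : ∀ i j, IsCkl k l (fun p => h p (basisVec i) (basisVec j)) U := fun i j =>
    (h1 i).clm hU (ContinuousLinearMap.apply ℝ ℝ (basisVec j))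
  have a1 : ∀ i, IsCkl k l (fun p => α p (basisVec i)) U := fun i =>
    hα.clm hU (ContinuousLinearMap.apply ℝ ℝ (basisVec i))
  have hd : IsCkl k l (fun p => gramDet (h p)) U :=
    (IsCkl.bilinear hU (ContinuousLinearMap.mul ℝ ℝ) (h2 0 0) (h2 1 1)).sub hU
      (IsCkl.bilinear hU (ContinuousLinearMap.mul ℝ ℝ) (h2 0 1) (h2 1 0))
  have hs : ContDiffOn ℝ k (fun x : ℝ => (√x)⁻¹) (Ioi 0) := by
    refine ContDiffOn.inv (ContDiffOn.sqrt contDiffOn_id fun x hx => (mem_Ioi.1 hx).ne') ?_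
    exact fun x hx => (Real.sqrt_pos.2 hx).ne'
  have hd' := IsCkl.contDiffOn_comp hU isOpen_Ioi hs hpos hd
  have hB : ∀ {F : Type} [NormedAddCommGroup F] [NormedSpace ℝ F] {s : Model → ℝ} {f : Model → F},
      IsCkl k l s U → IsCkl k l f U → IsCkl k l (fun p => s p • f p) U := fun hs hf =>
    IsCkl.bilinear hU (ContinuousLinearMap.lsmul ℝ ℝ) hs hf
  exact hB hd' ((hB (a1 0) (h1 1)).sub hU (hB (a1 1) (h1 0)))

/-- The components `√(det G) G^{ij} αⱼ` whose divergence is the Laplace-Beltrami operator are, up to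
sign, the components of the Hodge star. -/
theorem laplaceBeltrami_term (h : Plane →L[ℝ] Plane →L[ℝ] ℝ) (α : Plane →L[ℝ] ℝ)
    (G : Matrix (Fin 2) (Fin 2) ℝ)
    (hG : G = fun i j => h (basisVec i) (basisVec j)) :
    √G.det * ∑ j, G⁻¹ 0 j * α (basisVec j) = hodgeStar h α (basisVec 1) ∧
      √G.det * ∑ j, G⁻¹ 1 j * α (basisVec j) = -hodgeStar h α (basisVec 0) := by
  have hdet : G.det = gramDet h := by rw [Matrix.det_fin_two, hG]; rfl
  have hs : √(gramDet h) * (gramDet h)⁻¹ = (√(gramDet h))⁻¹ := by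
    rw [← div_eq_mul_inv, Real.sqrt_div_self']
    exact one_div _
  rw [Matrix.inv_def, Ring.inverse_eq_inv', hdet, Matrix.adjugate_fin_two, hodgeStar_apply,
    hodgeStar_apply, ← hs, hG]
  constructor <;> simp [Fin.sum_univ_two] <;> ring

theorem differentiableAt_formRep {M : Type*} [TopologicalSpace M]
    [ChartedSpace Model M] {n : ℕ} {ω : M → Plane [⋀^Fin n]→L[ℝ] ℝ}
    (hω : ω ∈ LeafForm M n) (x : M) : DifferentiableAt ℝ
      (fun u : Plane => formRep ω (chartAt Model x) (u, (chartAt Model x x).2))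
      (chartAt Model x x).1 :=
  (hω _ (chart_mem_atlas Model x) 1).leaf.1 _
    ((chartAt Model x).map_source (mem_chart_source Model x))

variable {M : Type*} [TopologicalSpace M] [ChartedSpace Model M] [C2Foliation M]
variable {e : OpenPartialHomeomorph M Model} {p : Model}

theorem leafChange_det_pos (he : e ∈ atlas Model M) (hp : p ∈ e.target) :
    0 < (leafChange e p).det :=
  C2Foliation.leaf_oriented e he _ (chart_mem_atlas _ _) p
    (mem_transition_source hp (mem_chart_source _ _))

theorem LeafMetric.gramDet_metricRep_pos (g : LeafMetric M) (he : e ∈ atlas Model M)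
    (hp : p ∈ e.target) : 0 < gramDet (metricRep g.toFun e p) := by
  rw [metricRep, gramDet_comp]
  exact mul_pos (pow_pos (leafChange_det_pos he hp) 2) (gramDet_pos (g.symm _) (g.pos _))

/-- The leafwise 1-form `*d log f_τ`. -/
def starDLogRN (g : LeafMetric M) (τ : TransverseMeasure M) (x : M) : Plane [⋀^Fin 1]→L[ℝ] ℝ :=
  ContinuousAlternatingMap.ofSubsingleton ℝ Plane ℝ 0 (hodgeStar (g.toFun x) (dLogRN τ x))

theorem formRep_starDLogRN (g : LeafMetric M) (τ : TransverseMeasure M) (he : e ∈ atlas Model M)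
    (hp : p ∈ e.target) : formRep (starDLogRN g τ) e p =
      ContinuousAlternatingMap.ofSubsingleton ℝ Plane ℝ 0 (hodgeStar (metricRep g.toFun e p)
        (leafDeriv (fun q => Real.log (τ.coeff e q)) p)) := by
  rw [← dLogRN_comp_leafChange τ he hp, metricRep,
    ← hodgeStar_comp _ _ _ (leafChange_det_pos he hp)]
  ext v
  rfl

theorem starDLogRN_mem (g : LeafMetric M) (τ : TransverseMeasure M) :
    starDLogRN g τ ∈ LeafForm M 1 := fun e he k => by
  have h := IsCkl.hodgeStar e.open_target (g.regular e he k)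
    ((τ.isCInf_log_coeff he (k + 1)).leaf.2) fun p hp => g.gramDet_metricRep_pos he hp
  exact (h.clm e.open_target (ContinuousAlternatingMap.ofSubsingletonLIE (𝕜 := ℝ) (E := Plane)
    (F := ℝ) (0 : Fin 1)).toContinuousLinearEquiv.toContinuousLinearMap).congr e.open_target
      fun p hp => (formRep_starDLogRN g τ he hp).symm

/-- The exterior derivative of `*d log f_τ` is the Laplacian of `log f_τ` times the area form of the
leaf. -/
theorem dFun_starDLogRN (g : LeafMetric M) (τ : TransverseMeasure M) (x : M) :
    dFun (starDLogRN g τ) x ![basisVec 0, basisVec 1] =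
      √(g.gram (chartAt Model x) (chartAt Model x x).2 (chartAt Model x x).1).det *
        laplaceBeltrami (g.gram (chartAt Model x) (chartAt Model x x).2)
          (logRN τ (LeafPath.refl (b := x)) (chartAt Model x)) (chartAt Model x x).1 := by
  have hxs := mem_chart_source Model x
  have he := chart_mem_atlas Model x
  rw [dFun, extDeriv_apply (differentiableAt_formRep (starDLogRN_mem g τ) x)]
  set e := chartAt Model x
  have hxt : ((e x).1, (e x).2) ∈ e.target := e.map_source hxs
  have hdet : (g.gram e (e x).2 (e x).1).det = gramDet (metricRep g.toFun e (e x)) := by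
    rw [Matrix.det_fin_two]; rfl
  have hpos : √(g.gram e (e x).2 (e x).1).det ≠ 0 := by
    rw [hdet]
    exact (Real.sqrt_pos.2 (g.gramDet_metricRep_pos he hxt)).ne'
  rw [laplaceBeltrami, mul_inv_cancel_left₀ hpos, Fin.sum_univ_two, Fin.sum_univ_two]
  have hev := slice_leaf_mem e.open_target hxt
  have e0 : (fun u : Plane => formRep (starDLogRN g τ) e (u, (e x).2)
      (Fin.removeNth 0 ![basisVec 0, basisVec 1])) =ᶠ[𝓝 (e x).1] fun y =>
        √(g.gram e (e x).2 y).det * ∑ j, (g.gram e (e x).2 y)⁻¹ 0 j *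
          fderiv ℝ (logRN τ (LeafPath.refl (b := x)) e) y (basisVec j) := by
    filter_upwards [hev] with u hu
    rw [formRep_starDLogRN g τ he hu, fderiv_logRN_refl τ he hxs hu,
      (laplaceBeltrami_term (metricRep g.toFun e (u, (e x).2)) _ (g.gram e (e x).2 u) rfl).1]
    rfl
  have e1 : (fun u : Plane => formRep (starDLogRN g τ) e (u, (e x).2)
      (Fin.removeNth 1 ![basisVec 0, basisVec 1])) =ᶠ[𝓝 (e x).1] fun y =>
        -(√(g.gram e (e x).2 y).det * ∑ j, (g.gram e (e x).2 y)⁻¹ 1 j *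
          fderiv ℝ (logRN τ (LeafPath.refl (b := x)) e) y (basisVec j)) := by
    filter_upwards [hev] with u hu
    rw [formRep_starDLogRN g τ he hu, fderiv_logRN_refl τ he hxs hu,
      (laplaceBeltrami_term (metricRep g.toFun e (u, (e x).2)) _ (g.gram e (e x).2 u) rfl).2,
      neg_neg]
    rfl
  rw [e0.fderiv_eq, e1.fderiv_eq, fderiv_fun_neg]
  simp

end StarForm

/-! ### Cones of currents -/

section Cones

theorem currentCone_apply_nonneg {M : Type*} [TopologicalSpace M] [ChartedSpace Model M] {n : ℕ}
    {A : Set (LeafCurrent M n)} {S : LeafCurrent M n} (hS : S ∈ currentCone A) {ω : LeafForm M n}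
    (h : ∀ T ∈ A, 0 ≤ T ω) : 0 ≤ S ω := by
  have hcl : IsClosed {f : LeafForm M n → ℝ | 0 ≤ f ω} :=
    isClosed_le continuous_const (continuous_apply ω)
  refine closure_minimal ?_ hcl hS
  rintro _ ⟨T, hT, rfl⟩
  refine Submodule.span_induction (p := fun T _ => 0 ≤ T ω) h (by simp) ?_ ?_ hT
  · exact fun T T' _ _ h h' => add_nonneg h h'
  · exact fun c T _ h => mul_nonneg c.2 h

theorem formRep_basis {M : Type*} [TopologicalSpace M] [ChartedSpace Model M]
    {ω : M → Plane [⋀^Fin 2]→L[ℝ] ℝ}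
    {e : OpenPartialHomeomorph M Model} {p : Model} :
    formRep ω e p ![basisVec 0, basisVec 1] =
      (leafChange e p).det * ω (e.symm p) ![basisVec 0, basisVec 1] := by
  rw [← alternating_map_basis, formRep, ContinuousAlternatingMap.compContinuousLinearMap_apply]
  congr 1
  funext i; fin_cases i <;> rfl

variable {M : Type*} [TopologicalSpace M] [ChartedSpace Model M] [C2Foliation M]

/-- Each value on the preferred basis may be discontinuous in `x`, but in a quotient of two leafwise
2-forms the determinants of the changes of charts cancel. -/
theorem continuous_form_quotient (ω Ω : LeafForm M 2)
    (hΩ : ∀ x, Ω.1 x ![basisVec 0, basisVec 1] ≠ 0) :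
    Continuous fun x => ω.1 x ![basisVec 0, basisVec 1] / Ω.1 x ![basisVec 0, basisVec 1] := by
  refine continuous_iff_continuousAt.2 fun x₀ => ?_
  have hs := mem_chart_source Model x₀
  have he := chart_mem_atlas Model x₀
  set e := chartAt Model x₀
  have hdet : ∀ x ∈ e.source, (leafChange e (e x)).det ≠ 0 := fun x hx =>
    (leafChange_det_pos he (e.map_source hx)).ne'
  have hc : ∀ η : LeafForm M 2,
      ContinuousAt (fun x => formRep η.1 e (e x) ![basisVec 0, basisVec 1]) x₀ := fun η => by
    have h1 := (η.2 e he 0).clm e.open_target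
      (ContinuousAlternatingMap.apply ℝ Plane ℝ ![basisVec 0, basisVec 1])
    exact ContinuousAt.comp (g := fun p => formRep η.1 e p ![basisVec 0, basisVec 1])
      (h1.continuousOn.continuousAt (e.open_target.mem_nhds (e.map_source hs)))
      (e.continuousAt hs)
  refine ((hc ω).div (hc Ω) ?_).congr ?_
  · rw [formRep_basis, e.left_inv hs]
    exact mul_ne_zero (hdet _ hs) (hΩ _)
  · filter_upwards [e.open_source.mem_nhds hs] with x hx
    rw [Pi.div_apply, formRep_basis, formRep_basis, e.left_inv hx, mul_div_mul_left _ _ (hdet x hx)]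

/-- A non-zero current of the co-oriented cone is positive on every positive form `Ω`, since by
compactness every form lies between two multiples of `Ω`. -/
theorem coorientedCone_apply_pos [CompactSpace M] {S : LeafCurrent M 2} (hS : S ∈ coorientedCone M)
    (h0 : S ≠ 0) (Ω : LeafForm M 2) (hΩ : ∀ x, 0 < Ω.1 x ![basisVec 0, basisVec 1]) :
    0 < S Ω := by
  have hnn : ∀ ω : LeafForm M 2, (∀ x, 0 ≤ ω.1 x ![basisVec 0, basisVec 1]) → 0 ≤ S ω :=
    fun ω hω => currentCone_apply_nonneg hS (by rintro _ ⟨x, rfl⟩; exact hω x)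
  refine lt_of_le_of_ne (hnn Ω fun x => (hΩ x).le) fun hzero => h0 (LinearMap.ext fun ω => ?_)
  obtain ⟨C, hC⟩ := isCompact_univ.exists_bound_of_continuousOn
    (continuous_form_quotient ω Ω fun x => (hΩ x).ne').continuousOn
  have hb : ∀ x, |ω.1 x ![basisVec 0, basisVec 1]| ≤ C * Ω.1 x ![basisVec 0, basisVec 1] :=
    fun x => by
      have := hC x (mem_univ x)
      rwa [Real.norm_eq_abs, abs_div, abs_of_pos (hΩ x), div_le_iff₀ (hΩ x)] at this
  have h1 := hnn (C • Ω + (-1 : ℝ) • ω) fun x => by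
    have h : 0 ≤ C * Ω.1 x ![basisVec 0, basisVec 1] + -1 * ω.1 x ![basisVec 0, basisVec 1] := by
      linarith [(abs_le.1 (hb x)).2]
    exact h
  have h2 := hnn (C • Ω + ω) fun x => by
    have := (abs_le.1 (hb x)).1
    exact neg_le_iff_add_nonneg'.1 this
  rw [map_add, map_smul, map_smul, ← hzero, smul_zero, smul_eq_mul] at h1
  rw [map_add, map_smul, ← hzero, smul_zero] at h2
  rw [LinearMap.zero_apply]
  linarith

end Cones
end LeafwiseCurrents
end

open LeafwiseCurrents in
theorem mainTheorem8 {M : Type*} [TopologicalSpace M] [T2Space M] [CompactSpace M]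
    [ChartedSpace LeafwiseCurrents.Model M] [LeafwiseCurrents.C2Foliation M]
    (g : LeafwiseCurrents.LeafMetric M) (τ : LeafwiseCurrents.TransverseMeasure M)
    (hτ : LeafwiseCurrents.StrictlyLogSuperharmonic g τ) :
    ¬ ∃ S : LeafwiseCurrents.LeafCurrent M 2, LeafwiseCurrents.IsObstruction τ S := by
  rintro ⟨S, hS⟩
  let β : LeafForm M 1 := ⟨starDLogRN g τ, starDLogRN_mem g τ⟩
  have hneg : ∀ x, dFun (starDLogRN g τ) x ![basisVec 0, basisVec 1] < 0 := fun x => by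
    have he := chart_mem_atlas Model x
    have hx := mem_chart_source Model x
    rw [dFun_starDLogRN]
    refine mul_neg_of_pos_of_neg (Real.sqrt_pos.2 ?_) (hτ x x LeafPath.refl _ he hx)
    rw [Matrix.det_fin_two]
    exact g.gramDet_metricRep_pos he ((chartAt Model x).map_source hx)
  have h1 : 0 < S ((-1 : ℝ) • leafD M 1 β) :=
    coorientedCone_apply_pos hS.cooriented hS.ne_zero _ fun x =>
      (neg_pos.2 (hneg x)).trans_eq (neg_one_mul _).symm
  have h2 : 0 ≤ (-boundary S) ((-1 : ℝ) • β) := by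
    refine currentCone_apply_nonneg hS.boundary_neg ?_
    rintro _ ⟨x, v, hv, rfl⟩
    exact (neg_nonneg.2 (hodgeStar_nonpos (g.pos x) hv.1 hv.2)).trans_eq (neg_one_mul _).symm
  have h3 : (-boundary S) ((-1 : ℝ) • β) = S (leafD M 1 β) := by
    rw [map_smul, LinearMap.neg_apply, smul_eq_mul, neg_one_mul, neg_neg]
    rfl
  rw [h3] at h2
  rw [map_smul, smul_eq_mul] at h1
  linarith
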